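/- Let $X$ be a homogeneous Markov jump process on a finite state space $\mathcal S$, on a time interval $[t_{\min},t_{\max}]$ with $t_{\min}<t_{\max}$, with initial distribution $\nu$ and transition intensities $Q(s,s')\ge 0$ ($s\ne s'$), and put $Q(s)=\sum_{s'\ne s}Q(s,s')$. Assume that $Q$ is irreducible, and let $\lambda>\max_s Q(s)$. Let $P(s,s')=Q(s,s')/\lambda$ for $s\neq s'$ and $P(s,s)=1-Q(s)/\lambda$. Let $t_{\min}\le t^{\rm obs}_1<\dots<t^{\rm obs}_k\le t_{\max}$ be fixed, and let the likelihood of the (fixed) observation be $L(Y|X)=\prod_{j=1}^k L_j(X(t_j^{\rm obs}))$ with functions $L_j:\mathcal S\to[0,\infty)$. A trajectory is a right continuous, piecewise constant function $X:[t_{\min},t_{\max}]\to\mathcal S$ with finitely many jumps, all in $(t_{\min},t_{\max})$; $J(X)$ denotes the finite set of its (true) jump times. For a finite set $T=\{T_1<\dots<T_N\}\subset(t_{\min},t_{\max})$ and a skeleton $\sigma=(\sigma_0,\dots,\sigma_N)\in\mathcal S^{N+1}$ let $X_{T,\sigma}$ be the trajectory equal to $\sigma_i$ on $[T_i,T_{i+1})$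 (with $T_0=t_{\min}$, and equal to $\sigma_N$ up to and including $t_{\max}$), and let $$w(T,\sigma)=\nu(\sigma_0)\prod_{i=1}^{N}P(\sigma_{i-1},\sigma_i)\; L(Y|X_{T,\sigma}),\qquad Z(T)=\sum_\sigma w(T,\sigma),\qquad p(\sigma|T,Y)=\frac{w(T,\sigma)}{Z(T)}.$$ One step of Rao and Teh's algorithm from a trajectory $X$ is as follows: sample a Poisson process $V$ on the time interval with intensity $\lambda-Q(X(t))$, put $T'=J(X)\cup V$, draw $\sigma'$ from $p(\cdot\,|T',Y)$, and return $X'=X_{T',\sigma'}$. (A jump time in $T'$ at which $\sigma'$ does not change is thereby discarded.) Then there exist $q<1$, $q\geq 0$, and $c<\infty$ such that for every trajectory $X$ with $Z(J(X))>0$ (in particular for every $X$ of positive posterior density) the step is well defined, that is, it yields a probability distribution of $X'$, and $$\mathbb E\big(|J(X')|\,\big|\,X\big)\le q\,|J(X)|+c .$$ -/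

import Mathlib

open MeasureTheory Set
open scoped NNReal ENNReal

noncomputable section

/-- The path `x` on `[a, b]` is constant on every interval `[s, t]` such that no point of `T` lies
in `(s, t]`. In other words, if `T₁ < ⋯ < T_N` are the points of `T` then `x` is constant on each of
`[a, T₁)`, `[T₁, T₂)`, …, `[T_N, b]`. -/
def ConstantBetween {S : Type*} {a b : ℝ} (T : Finset (Ioo a b)) (x : Icc a b → S) : Prop :=
  ∀ s t : Icc a b, s ≤ t → (∀ τ ∈ T, ¬ ((s : ℝ) < τ ∧ (τ : ℝ) ≤ t)) → x s = x t

/-- Trajectories: right continuous, piecewise constant paths on `[a, b]` with finitely many jumps,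
all of them in `(a, b)`. -/
structure Trajectory (S : Type*) (a b : ℝ) where
  path : Icc a b → S
  exists_constantBetween : ∃ T : Finset (Ioo a b), ConstantBetween T path

namespace Trajectory

variable {S : Type*} {a b : ℝ}

/-- The σ-algebra generated by the coordinates `X ↦ X(t)`, the state space being discrete. -/
instance : MeasurableSpace (Trajectory S a b) :=
  ⨆ t : Icc a b, MeasurableSpace.comap (fun X : Trajectory S a b => X.path t) ⊤

/-- The set of true jumps: the points `τ` such that `X` takes a value other than `X(τ)` at times
`u < τ` arbitrarily close to `τ`. -/
def jumpSet (X : Trajectory S a b) : Set (Ioo a b) :=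
  {τ | ∀ s : Icc a b, (s : ℝ) < τ →
    ∃ u : Icc a b, s ≤ u ∧ (u : ℝ) < τ ∧ X.path u ≠ X.path ⟨τ, Ioo_subset_Icc_self τ.2⟩}

theorem finite_jumpSet (X : Trajectory S a b) : X.jumpSet.Finite := by
  obtain ⟨T, hT⟩ := X.exists_constantBetween
  refine T.finite_toSet.subset fun τ hτ => ?_
  by_contra hτT
  have hτT' : τ ∉ T := by simpa using hτT
  -- a point of `[a, τ)` to the right of all points of `T` below `τ`
  have key : ∀ U : Finset (Ioo a b), ∃ s : Icc a b, (s : ℝ) < τ ∧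
      ∀ ρ ∈ U, (ρ : ℝ) < τ → (ρ : ℝ) ≤ s := by
    intro U
    induction U using Finset.induction_on with
    | empty => exact ⟨⟨a, le_refl a, (τ.2.1.trans τ.2.2).le⟩, τ.2.1, by simp⟩
    | insert ρ U _ ih =>
      obtain ⟨s, hs, hU⟩ := ih
      by_cases hρ : (ρ : ℝ) < τ
      · refine ⟨max s ⟨ρ, Ioo_subset_Icc_self ρ.2⟩, ?_, ?_⟩
        · rcases max_choice s ⟨ρ, Ioo_subset_Icc_self ρ.2⟩ with h | h <;> rw [h] <;> assumption
        · intro π hπ hlt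
          rcases Finset.mem_insert.1 hπ with rfl | hπ
          · exact le_max_right s ⟨(π : ℝ), Ioo_subset_Icc_self π.2⟩
          · exact (hU π hπ hlt).trans (le_max_left s ⟨(ρ : ℝ), Ioo_subset_Icc_self ρ.2⟩)
      · refine ⟨s, hs, fun π hπ hlt => ?_⟩
        rcases Finset.mem_insert.1 hπ with rfl | hπ
        · exact absurd hlt hρ
        · exact hU π hπ hlt
  obtain ⟨s, hs, hsT⟩ := key T
  obtain ⟨u, hsu, huτ, hne⟩ := hτ s hs
  refine hne (hT u ⟨τ, Ioo_subset_Icc_self τ.2⟩ huτ.le fun ρ hρ h => ?_)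
  have h1 : (ρ : ℝ) ≤ τ := h.2
  rcases h1.lt_or_eq with h2 | h2
  · have h3 : (s : ℝ) ≤ u := hsu
    linarith [hsT ρ hρ h2, h.1]
  · exact hτT' (Subtype.ext h2 ▸ hρ)

/-- The finite set `J(X)` of true jumps of the trajectory `X`. -/
def jumps (X : Trajectory S a b) : Finset (Ioo a b) :=
  X.finite_jumpSet.toFinset

/-- The index `i(t) = max {i : T_i ≤ t}` (with `T₀ = a`), for `T = {T₁ < ⋯ < T_N}`: the number of
points of `T` in `(a, t]`. -/
def index (T : Finset (Ioo a b)) (t : Icc a b) : Fin (T.card + 1) :=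
  ⟨(T.filter fun τ : Ioo a b => (τ : ℝ) ≤ (t : ℝ)).card, Nat.lt_succ_of_le (Finset.card_filter_le _ _)⟩

/-- The trajectory with potential jump times `T = {T₁ < ⋯ < T_N}` and skeleton `(σ₀, …, σ_N)`:
`X(t) = σ_i` for `T_i ≤ t < T_{i+1}`. Neighbouring states may coincide (virtual jumps). -/
def ofSkeleton (T : Finset (Ioo a b)) (σ : Fin (T.card + 1) → S) : Trajectory S a b where
  path t := σ (index T t)
  exists_constantBetween := by
    refine ⟨T, fun s t hst h => ?_⟩
    have hst' : (s : ℝ) ≤ t := hst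
    have : index T s = index T t := by
      refine Fin.ext ?_
      refine congrArg Finset.card (Finset.filter_congr fun τ hτ => ?_)
      exact ⟨fun h' => h'.trans hst', fun h' => not_lt.1 fun h'' => h τ hτ ⟨h'', h'⟩⟩
    exact congrArg σ this

end Trajectory

/-- The law of a Poisson process with finite intensity measure `Λ` on `E`. A configuration of `n`
points is listed as `v : Fin n → E`; the part of the law on configurations of `n` points is
`exp (-Λ(E)) / n!` times the product measure `Λ^{⊗ n}`, that is, the number of points is Poisson
with mean `Λ(E)`, and given their number the points are independent with law `Λ / Λ(E)`. -/
def poissonProcessLaw {E : Type*} [MeasurableSpace E] (Λ : Measure E) :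
    Measure (Σ n : ℕ, (Fin n → E)) :=
  Measure.sum fun n : ℕ =>
    ENNReal.ofReal (Real.exp (-(Λ univ).toReal) / (n.factorial : ℝ)) •
      (Measure.pi fun _ : Fin n => Λ).map (Sigma.mk n)

/-- A hidden homogeneous Markov jump process on the finite state space `S`, observed with noise at
`k` deterministic times. The observation `Y` is fixed: `lik j s` stands for `L_j(Y_j | s)`. The
diagonal values of `rate` are irrelevant. -/
structure HiddenMJP (S : Type*) [Fintype S] where
  tmin : ℝ
  tmax : ℝ
  tmin_lt_tmax : tmin < tmax
  /-- transition intensities `Q(s, s')` for `s ≠ s'` -/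
  rate : S → S → ℝ
  rate_nonneg : ∀ s s', s ≠ s' → 0 ≤ rate s s'
  /-- initial distribution `ν` -/
  init : S → ℝ
  init_nonneg : ∀ s, 0 ≤ init s
  sum_init : ∑ s, init s = 1
  /-- number of observations -/
  k : ℕ
  obsTime : Fin k → Icc tmin tmax
  obsTime_strictMono : StrictMono obsTime
  lik : Fin k → S → ℝ
  lik_nonneg : ∀ j s, 0 ≤ lik j s

namespace HiddenMJP

variable {S : Type*} [Fintype S] [DecidableEq S]

/-- The intensity `Q(s) = ∑_{s' ≠ s} Q(s, s')` of leaving `s`. -/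
def exitRate (M : HiddenMJP S) (s : S) : ℝ :=
  ∑ s' ∈ Finset.univ.erase s, M.rate s s'

/-- Irreducibility of the matrix of intensities: every state can be reached from every other one
through transitions of positive intensity. -/
def Irreducible (M : HiddenMJP S) : Prop :=
  ∀ s s', Relation.ReflTransGen (fun u v => u ≠ v ∧ 0 < M.rate u v) s s'

/-- The transition matrix `P` of the uniformized chain. -/
def transition (M : HiddenMJP S) (lam : ℝ) (s s' : S) : ℝ :=
  if s = s' then 1 - M.exitRate s / lam else M.rate s s' / lam

/-- The probability `p(σ | T) = ν(σ₀) ∏_i P(σ_{i-1}, σ_i)` of the skeleton `σ`, given potential jump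
times `T`. -/
def skeletonPrior (M : HiddenMJP S) (lam : ℝ) (T : Finset (Ioo M.tmin M.tmax))
    (σ : Fin (T.card + 1) → S) : ℝ :=
  M.init (σ 0) * ∏ i : Fin T.card, M.transition lam (σ i.castSucc) (σ i.succ)

/-- The likelihood `L(Y | X) = ∏_j L_j(Y_j | X(t_j))`. -/
def likelihood (M : HiddenMJP S) (X : Trajectory S M.tmin M.tmax) : ℝ :=
  ∏ j, M.lik j (X.path (M.obsTime j))

/-- The unnormalized posterior weight `p(σ | T) L(Y | T, σ)`. -/
def skeletonWeight (M : HiddenMJP S) (lam : ℝ) (T : Finset (Ioo M.tmin M.tmax))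
    (σ : Fin (T.card + 1) → S) : ℝ :=
  M.skeletonPrior lam T σ * M.likelihood (Trajectory.ofSkeleton T σ)

/-- The normalizing constant `p(Y | T) = ∑_σ p(σ | T) L(Y | T, σ)`. -/
def normalizer (M : HiddenMJP S) (lam : ℝ) (T : Finset (Ioo M.tmin M.tmax)) : ℝ :=
  ∑ σ : Fin (T.card + 1) → S, M.skeletonWeight lam T σ

/-- Stage (S): the law of the trajectory obtained by drawing a new skeleton from the conditional
distribution `p(σ | T, Y)`. -/
def skeletonStage (M : HiddenMJP S) (lam : ℝ) (T : Finset (Ioo M.tmin M.tmax)) :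
    Measure (Trajectory S M.tmin M.tmax) :=
  ∑ σ : Fin (T.card + 1) → S,
    ENNReal.ofReal (M.skeletonWeight lam T σ / M.normalizer lam T) •
      Measure.dirac (Trajectory.ofSkeleton T σ)

/-- The intensity measure `(λ - Q(X(t))) dt` of the virtual jumps, given the trajectory `X`. -/
def virtualIntensity (M : HiddenMJP S) (lam : ℝ) (X : Trajectory S M.tmin M.tmax) :
    Measure (Ioo M.tmin M.tmax) :=
  (volume.comap (Subtype.val : Ioo M.tmin M.tmax → ℝ)).withDensity fun t =>
    ENNReal.ofReal (lam - M.exitRate (X.path ⟨t, Ioo_subset_Icc_self t.2⟩))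

/-- One step of the algorithm of Rao and Teh, that is, the law `A(X, dX')` of the new trajectory:
draw a Poisson process `V` with intensity `λ - Q(X(t))`, put `T' = J(X) ∪ V`, and draw a new skeleton
from `p(σ | T', Y)`. -/
def raoTehStep (M : HiddenMJP S) (lam : ℝ) (X : Trajectory S M.tmin M.tmax) :
    Measure (Trajectory S M.tmin M.tmax) :=
  (poissonProcessLaw (M.virtualIntensity lam X)).bind fun V =>
    M.skeletonStage lam (X.jumps ∪ Finset.univ.image V.2)

end HiddenMJP

end

/-! Given `N` potential jump times, the number of jumps of the new trajectory is at most the number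
of moves of the skeleton, so it suffices that the skeleton stays put at a positive fraction of its
`N` steps on average. By irreducibility and `P(s,s) > 0`, there are a length `m` and a weight `η >
0` such that any two states are joined by a path of `m` transitions with weight at least `η` that
stays put at least once (`exists_stayingBridge`).

Cut the `N` steps into windows of length `m`. In a window with no observation in its interior,
replacing the skeleton by such a bridge leaves the likelihood unchanged, costs at most a factor `η`
in weight, and is at most `|S|^m` to one. Hence, under the normalized weights, the skeleton stays
put somewhere in that window with probability at least `ε = η / |S|^m`
(`StayingBridge.mul_sum_le_sum_stay`). The bound depends neither on `N` nor on the likelihood, whose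
values may vanish. At least `N/m - k - 1` windows are free, so the mean number of moves is at most
`(1 - ε/m) N + ε (k + 1)` (`StayingBridge.sum_pathWeight_mul_moveCount_le`).

Finally `N ≤ |J(X)| + |V|`, and the mean of `|V|` is at most `λ (tmax - tmin)`, whatever `X` is. The
step is well defined because adding points to `J(X)` keeps the normalizer positive: a skeleton of
positive weight may stay put at the new points (`normalizer_pos_of_subset`). -/

noncomputable section

/-! ### Combinatorics of weighted skeletons: bridges, windows, and the mean number of moves -/

section Skeleton

variable {S : Type*} {N : ℕ}

/-- A skeleton `(σ₀, …, σ_N)` as a sequence on `ℕ`, constant from `N` on. -/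
def natExt (σ : Fin (N + 1) → S) (n : ℕ) : S :=
  σ ⟨min n N, Nat.lt_succ_of_le (min_le_right n N)⟩

theorem natExt_val (σ : Fin (N + 1) → S) (i : Fin (N + 1)) : natExt σ i = σ i := by
  unfold natExt
  congr 1
  ext
  simp [Nat.le_of_lt_succ i.2]

theorem prod_fin_eq_prod_range_natExt (P : S → S → ℝ) (σ : Fin (N + 1) → S) :
    ∏ i : Fin N, P (σ i.castSucc) (σ i.succ) =
      ∏ n ∈ Finset.range N, P (natExt σ n) (natExt σ (n + 1)) := by
  rw [Finset.prod_range]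
  refine Finset.prod_congr rfl fun i _ => ?_
  rw [← natExt_val σ i.castSucc, ← natExt_val σ i.succ]
  simp

/-- The weight of a skeleton with initial weights `ν`, transition weights `P`, and factors
`L j` evaluated at the positions `o j`. -/
def pathWeight {k : ℕ} (ν : S → ℝ) (P : S → S → ℝ) (L : Fin k → S → ℝ) (o : Fin k → Fin (N + 1))
    (σ : Fin (N + 1) → S) : ℝ :=
  ν (σ 0) * (∏ i : Fin N, P (σ i.castSucc) (σ i.succ)) * ∏ j, L j (σ (o j))

/-- The number of positions at which a skeleton changes. -/
def moveCount [DecidableEq S] (σ : Fin (N + 1) → S) : ℕ :=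
  ((Finset.range N).filter fun n => natExt σ n ≠ natExt σ (n + 1)).card

/-- Replace the part of `σ` between the positions `p` and `p + m` by the sequence `c s s'` that
joins its end points. -/
def splice (c : S → S → ℕ → S) (m p : ℕ) (σ : Fin (N + 1) → S) : Fin (N + 1) → S := fun i =>
  if p ≤ i ∧ (i : ℕ) ≤ p + m then c (natExt σ p) (natExt σ (p + m)) (i - p) else σ i

/-- Families of paths of length `m` along transitions of `P`, joining all pairs of states, each
staying put at least once, and having weight at least `η`. -/
structure StayingBridge (P : S → S → ℝ) (m : ℕ) (c : S → S → ℕ → S) (η : ℝ) : Prop where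
  length_pos : 0 < m
  start : ∀ s s', c s s' 0 = s
  finish : ∀ s s', c s s' m = s'
  stay : ∀ s s', ∃ l < m, c s s' l = c s s' (l + 1)
  weight_pos : 0 < η
  le_weight : ∀ s s', η ≤ ∏ l ∈ Finset.range m, P (c s s' l) (c s s' (l + 1))

variable {P : S → S → ℝ} {m : ℕ} {c : S → S → ℕ → S} {η : ℝ}

theorem natExt_splice (c : S → S → ℕ → S) (m p : ℕ) (σ : Fin (N + 1) → S) {n : ℕ} (hn : n ≤ N) :
    natExt (splice c m p σ) n =
      if p ≤ n ∧ n ≤ p + m then c (natExt σ p) (natExt σ (p + m)) (n - p) else natExt σ n := by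
  simp only [natExt, splice, min_eq_left hn]

/-- The bridge has the same end points as the piece it replaces. Observations at the ends of a
window are therefore harmless; only those strictly inside matter. -/
theorem StayingBridge.splice_eq_of_not_interior (h : StayingBridge P m c η) (σ : Fin (N + 1) → S)
    {p : ℕ} (i : Fin (N + 1)) (hi : ¬ (p < i ∧ (i : ℕ) < p + m)) :
    splice c m p σ i = σ i := by
  unfold splice
  split_ifs with h'
  · rcases eq_or_ne p i with e | e
    · rw [← natExt_val σ i, ← e]
      simp [h.start]
    · have e' : (i : ℕ) = p + m := by omega
      rw [← natExt_val σ i, e']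
      simp [h.finish]
  · rfl

theorem StayingBridge.natExt_splice_of_not_interior (h : StayingBridge P m c η)
    (σ : Fin (N + 1) → S) {p n : ℕ} (hn : n ≤ N) (hi : ¬ (p < n ∧ n < p + m)) :
    natExt (splice c m p σ) n = natExt σ n := by
  have := h.splice_eq_of_not_interior σ ⟨n, Nat.lt_succ_of_le hn⟩ hi
  rwa [← natExt_val (splice c m p σ), ← natExt_val σ] at this

theorem StayingBridge.exists_stay_splice (h : StayingBridge P m c η) (σ : Fin (N + 1) → S) {p : ℕ}
    (hp : p + m ≤ N) :
    ∃ l < m, natExt (splice c m p σ) (p + l) = natExt (splice c m p σ) (p + l + 1) := by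
  obtain ⟨l, hl, e⟩ := h.stay (natExt σ p) (natExt σ (p + m))
  refine ⟨l, hl, ?_⟩
  rw [natExt_splice c m p σ (by omega), natExt_splice c m p σ (by omega), if_pos (by omega),
    if_pos (by omega)]
  simpa [add_assoc] using e

/-- The initial factor, the likelihood factors and the transitions outside the window are untouched.
Inside it, a product that is at most `1` is replaced by one that is at least `η`. -/
theorem StayingBridge.mul_pathWeight_le (h : StayingBridge P m c η) (hP0 : ∀ s s', 0 ≤ P s s')
    (hP1 : ∀ s s', P s s' ≤ 1) {k : ℕ} {ν : S → ℝ} {L : Fin k → S → ℝ} {o : Fin k → Fin (N + 1)}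
    (hν : ∀ s, 0 ≤ ν s) (hL : ∀ j s, 0 ≤ L j s) (σ : Fin (N + 1) → S) {p : ℕ} (hp : p + m ≤ N)
    (ho : ∀ j, ¬ (p < o j ∧ (o j : ℕ) < p + m)) :
    η * pathWeight ν P L o σ ≤ pathWeight ν P L o (splice c m p σ) := by
  unfold pathWeight
  rw [h.splice_eq_of_not_interior σ 0 (by simp)]
  simp only [h.splice_eq_of_not_interior σ _ (ho _)]
  have key : η * ∏ i : Fin N, P (σ i.castSucc) (σ i.succ) ≤
      ∏ i : Fin N, P (splice c m p σ i.castSucc) (splice c m p σ i.succ) := by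
    rw [prod_fin_eq_prod_range_natExt, prod_fin_eq_prod_range_natExt]
    have hsub : Finset.Ico p (p + m) ⊆ Finset.range N := by
      intro i hi
      simp only [Finset.mem_Ico, Finset.mem_range] at hi ⊢
      omega
    rw [← Finset.prod_sdiff hsub, ← Finset.prod_sdiff hsub]
    have e1 : ∏ n ∈ Finset.range N \ Finset.Ico p (p + m),
          P (natExt (splice c m p σ) n) (natExt (splice c m p σ) (n + 1)) =
        ∏ n ∈ Finset.range N \ Finset.Ico p (p + m), P (natExt σ n) (natExt σ (n + 1)) := by
      refine Finset.prod_congr rfl fun n hn => ?_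
      simp only [Finset.mem_sdiff, Finset.mem_Ico, Finset.mem_range] at hn
      rw [h.natExt_splice_of_not_interior σ (by omega) (by omega),
        h.natExt_splice_of_not_interior σ (by omega) (by omega)]
    have e2 : η ≤ ∏ n ∈ Finset.Ico p (p + m),
        P (natExt (splice c m p σ) n) (natExt (splice c m p σ) (n + 1)) := by
      refine (h.le_weight (natExt σ p) (natExt σ (p + m))).trans_eq ?_
      rw [Finset.prod_Ico_eq_prod_range]
      simp only [add_tsub_cancel_left]
      refine Finset.prod_congr rfl fun l hl => ?_
      rw [Finset.mem_range] at hl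
      rw [natExt_splice c m p σ (by omega), natExt_splice c m p σ (by omega), if_pos (by omega),
        if_pos (by omega)]
      congr 2 <;> omega
    have e3 : ∏ n ∈ Finset.Ico p (p + m), P (natExt σ n) (natExt σ (n + 1)) ≤ 1 :=
      Finset.prod_le_one (fun _ _ => hP0 _ _) fun _ _ => hP1 _ _
    rw [e1]
    have e4 : 0 ≤ ∏ n ∈ Finset.range N \ Finset.Ico p (p + m), P (natExt σ n) (natExt σ (n + 1)) :=
      Finset.prod_nonneg fun _ _ => hP0 _ _
    calc η * ((∏ n ∈ Finset.range N \ Finset.Ico p (p + m), P (natExt σ n) (natExt σ (n + 1))) *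
          ∏ n ∈ Finset.Ico p (p + m), P (natExt σ n) (natExt σ (n + 1)))
        ≤ η * ((∏ n ∈ Finset.range N \ Finset.Ico p (p + m),
          P (natExt σ n) (natExt σ (n + 1))) * 1) := by
          have := h.weight_pos.le
          gcongr
      _ = (∏ n ∈ Finset.range N \ Finset.Ico p (p + m), P (natExt σ n) (natExt σ (n + 1))) * η := by
          ring
      _ ≤ _ := by gcongr
  have hν' := hν (σ 0)
  have hL' : 0 ≤ ∏ j, L j (σ (o j)) := Finset.prod_nonneg fun _ _ => hL _ _
  calc _ = ν (σ 0) * (η * ∏ i : Fin N, P (σ i.castSucc) (σ i.succ)) * ∏ j, L j (σ (o j)) := by ring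
    _ ≤ _ := by gcongr

theorem pathWeight_nonneg {k : ℕ} {ν : S → ℝ} {L : Fin k → S → ℝ} {o : Fin k → Fin (N + 1)}
    (hP0 : ∀ s s', 0 ≤ P s s') (hν : ∀ s, 0 ≤ ν s) (hL : ∀ j s, 0 ≤ L j s) (σ : Fin (N + 1) → S) :
    0 ≤ pathWeight ν P L o σ :=
  mul_nonneg (mul_nonneg (hν _) (Finset.prod_nonneg fun _ _ => hP0 _ _))
    (Finset.prod_nonneg fun _ _ => hL _ _)

variable [DecidableEq S]

/-- The windows `[r m, (r + 1) m]` without observations in their interior. -/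
def freeWindows {k : ℕ} (m : ℕ) (o : Fin k → Fin (N + 1)) : Finset ℕ :=
  (Finset.range (N / m)).filter fun r => ∀ j, ¬ (r * m < o j ∧ (o j : ℕ) < r * m + m)

/-- An observation at position `o j` can lie in the interior of no window other than number `o j /
m`, so each observation spoils at most one window. -/
theorem div_le_card_freeWindows_add {k : ℕ} (m : ℕ) (o : Fin k → Fin (N + 1)) :
    N / m ≤ (freeWindows m o).card + k := by
  have h1 : Finset.range (N / m) ⊆
      freeWindows m o ∪ Finset.univ.image fun j : Fin k => (o j : ℕ) / m := by
    intro r hr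
    by_cases hg : ∀ j, ¬ (r * m < o j ∧ (o j : ℕ) < r * m + m)
    · exact Finset.mem_union_left _ (Finset.mem_filter.2 ⟨hr, hg⟩)
    · push Not at hg
      obtain ⟨j, h1, h2⟩ := hg
      refine Finset.mem_union_right _ (Finset.mem_image.2 ⟨j, Finset.mem_univ _, ?_⟩)
      exact Nat.div_eq_of_lt_le h1.le (by rw [add_mul, one_mul]; exact h2)
  have h2 := (Finset.card_le_card h1).trans (Finset.card_union_le _ _)
  have h3 : (Finset.univ.image fun j : Fin k => (o j : ℕ) / m).card ≤ k := by
    simpa using Finset.card_image_le (s := Finset.univ) (f := fun j : Fin k => (o j : ℕ) / m)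
  rw [Finset.card_range] at h2
  omega

/-- A step `n` belongs to window `n / m` only, so different windows provide different stays, and
stays and moves together number `N`. -/
theorem card_window_stay_add_moveCount_le {k : ℕ} (o : Fin k → Fin (N + 1)) (σ : Fin (N + 1) → S) :
    ((freeWindows m o).filter fun r =>
      ∃ l < m, natExt σ (r * m + l) = natExt σ (r * m + l + 1)).card + moveCount σ ≤ N := by
  have h1 : ((freeWindows m o).filter fun r =>
      ∃ l < m, natExt σ (r * m + l) = natExt σ (r * m + l + 1)) ⊆
      ((Finset.range N).filter fun n => ¬ natExt σ n ≠ natExt σ (n + 1)).image (· / m) := by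
    intro r hr
    simp only [freeWindows, Finset.mem_filter, Finset.mem_range] at hr
    obtain ⟨⟨hr, -⟩, l, hl, e⟩ := hr
    refine Finset.mem_image.2 ⟨r * m + l, ?_, ?_⟩
    · have h2 : (r + 1) * m ≤ N := (Nat.mul_le_mul_right m hr).trans (Nat.div_mul_le_self N m)
      rw [add_mul, one_mul] at h2
      simp only [Finset.mem_filter, Finset.mem_range, not_not]
      exact ⟨by omega, e⟩
    · exact Nat.div_eq_of_lt_le (by omega) (by rw [add_mul, one_mul]; omega)
  have h2 := (Finset.card_le_card h1).trans Finset.card_image_le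
  have h3 := Finset.card_filter_add_card_filter_not (s := Finset.range N)
    (fun n => natExt σ n ≠ natExt σ (n + 1))
  rw [Finset.card_range] at h3
  unfold moveCount
  omega

variable [Fintype S]

/-- Outside the interior of the window `σ` agrees with its image, so it is determined by its image
and its values at the `m` positions from `p` on. The value at `p` is redundant, but keeping it gives
a simpler bound. -/
theorem StayingBridge.card_fiber_splice_le (h : StayingBridge P m c η) (p : ℕ)
    (τ : Fin (N + 1) → S) :
    (Finset.univ.filter fun σ : Fin (N + 1) → S => splice c m p σ = τ).card ≤
      Fintype.card S ^ m := by
  have : Fintype.card S ^ m = (Finset.univ : Finset (Fin m → S)).card := by simp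
  rw [this]
  refine Finset.card_le_card_of_injOn (fun σ l => natExt σ (p + l)) (fun _ _ => by simp) ?_
  intro σ hσ σ' hσ' e
  simp only [Finset.coe_filter, Finset.mem_univ, true_and, mem_ofPred_eq] at hσ hσ'
  funext i
  by_cases hi : p < i ∧ (i : ℕ) < p + m
  · have := congrFun e ⟨i - p, by omega⟩
    simp only [show p + ((i : ℕ) - p) = i by omega, natExt_val] at this
    exact this
  · rw [← h.splice_eq_of_not_interior σ i hi, ← h.splice_eq_of_not_interior σ' i hi, hσ, hσ']

/-- A skeleton drawn from the normalized path weights stays put somewhere in a window free of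
observations with a probability bounded from below. -/
theorem StayingBridge.mul_sum_le_sum_stay (h : StayingBridge P m c η) (hP0 : ∀ s s', 0 ≤ P s s')
    (hP1 : ∀ s s', P s s' ≤ 1) {k : ℕ} {ν : S → ℝ} {L : Fin k → S → ℝ} {o : Fin k → Fin (N + 1)}
    (hν : ∀ s, 0 ≤ ν s) (hL : ∀ j s, 0 ≤ L j s) {p : ℕ} (hp : p + m ≤ N)
    (ho : ∀ j, ¬ (p < o j ∧ (o j : ℕ) < p + m)) :
    η / (Fintype.card S ^ m : ℕ) * ∑ σ, pathWeight ν P L o σ ≤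
      ∑ σ with ∃ l < m, natExt σ (p + l) = natExt σ (p + l + 1), pathWeight ν P L o σ := by
  have hw := pathWeight_nonneg (o := o) hP0 hν hL
  rcases isEmpty_or_nonempty S with hS | hS
  · have : IsEmpty (Fin (N + 1) → S) := ⟨fun σ => hS.elim (σ 0)⟩
    simp
  have hc : (0 : ℝ) < (Fintype.card S ^ m : ℕ) := by exact_mod_cast pow_pos Fintype.card_pos m
  rw [div_mul_eq_mul_div, div_le_iff₀ hc, Finset.mul_sum]
  -- Transport the weights along `splice` and group by the image `τ`: every image stays put in the
  -- window and has at most `|S|^m` preimages.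
  calc ∑ σ, η * pathWeight ν P L o σ
      ≤ ∑ σ, pathWeight ν P L o (splice c m p σ) :=
        Finset.sum_le_sum fun σ _ => h.mul_pathWeight_le hP0 hP1 hν hL σ hp ho
    _ = ∑ τ with ∃ l < m, natExt τ (p + l) = natExt τ (p + l + 1),
          ∑ σ with splice c m p σ = τ, pathWeight ν P L o (splice c m p σ) := by
        refine (Finset.sum_fiberwise_of_maps_to (fun σ _ => ?_) _).symm
        simpa using h.exists_stay_splice σ hp
    _ ≤ ∑ τ with ∃ l < m, natExt τ (p + l) = natExt τ (p + l + 1),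
          pathWeight ν P L o τ * (Fintype.card S ^ m : ℕ) := by
        refine Finset.sum_le_sum fun τ _ => ?_
        rw [Finset.sum_congr rfl (g := fun _ => pathWeight ν P L o τ)
          (fun σ hσ => by rw [(Finset.mem_filter.1 hσ).2]), Finset.sum_const, nsmul_eq_mul, mul_comm]
        exact mul_le_mul_of_nonneg_left (by exact_mod_cast h.card_fiber_splice_le p τ) (hw τ)
    _ = _ := by rw [Finset.sum_mul]

/-- The mean number of moves of a skeleton drawn from the normalized path weights. -/
theorem StayingBridge.sum_pathWeight_mul_moveCount_le (h : StayingBridge P m c η)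
    (hP0 : ∀ s s', 0 ≤ P s s') (hP1 : ∀ s s', P s s' ≤ 1) {k : ℕ} {ν : S → ℝ} {L : Fin k → S → ℝ}
    (o : Fin k → Fin (N + 1)) (hν : ∀ s, 0 ≤ ν s) (hL : ∀ j s, 0 ≤ L j s) {ε : ℝ} (hε0 : 0 ≤ ε)
    (hε : ε ≤ η / (Fintype.card S ^ m : ℕ)) :
    ∑ σ, pathWeight ν P L o σ * moveCount σ ≤
      ((1 - ε / m) * N + ε * (k + 1)) * ∑ σ, pathWeight ν P L o σ := by
  set Z := ∑ σ, pathWeight ν P L o σ with hZ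
  have hw := pathWeight_nonneg (o := o) hP0 hν hL
  have hZ0 : 0 ≤ Z := Finset.sum_nonneg fun σ _ => hw σ
  set W : (Fin (N + 1) → S) → Finset ℕ := fun σ => (freeWindows m o).filter fun r =>
      ∃ l < m, natExt σ (r * m + l) = natExt σ (r * m + l + 1) with hW
  have h1 : ∑ σ, pathWeight ν P L o σ * moveCount σ ≤
      ∑ σ, pathWeight ν P L o σ * (N - (W σ).card) := by
    refine Finset.sum_le_sum fun σ _ => mul_le_mul_of_nonneg_left ?_ (hw σ)
    have := card_window_stay_add_moveCount_le (m := m) o σ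
    have h' : ((W σ).card : ℝ) + moveCount σ ≤ N := by exact_mod_cast this
    linarith
  -- Double counting: the mean number of free windows with a stay is the sum over free windows of
  -- the probability of a stay, up to normalization.
  have h2 : ∑ σ, pathWeight ν P L o σ * (W σ).card =
      ∑ r ∈ freeWindows m o, ∑ σ with ∃ l < m, natExt σ (r * m + l) = natExt σ (r * m + l + 1),
        pathWeight ν P L o σ := by
    simp only [Finset.sum_filter]
    rw [Finset.sum_comm]
    refine Finset.sum_congr rfl fun σ _ => ?_
    rw [← Finset.sum_filter, Finset.sum_const, nsmul_eq_mul, mul_comm]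
  have h3 : (freeWindows m o).card * (ε * Z) ≤ ∑ σ, pathWeight ν P L o σ * (W σ).card := by
    rw [h2, ← nsmul_eq_mul]
    refine Finset.card_nsmul_le_sum _ _ _ fun r hr => ?_
    simp only [freeWindows, Finset.mem_filter, Finset.mem_range] at hr
    have h2 : (r + 1) * m ≤ N := (Nat.mul_le_mul_right m hr.1).trans (Nat.div_mul_le_self N m)
    rw [add_mul, one_mul] at h2
    exact (mul_le_mul_of_nonneg_right hε hZ0).trans
      (h.mul_sum_le_sum_stay hP0 hP1 hν hL h2 hr.2)
  have hm : (0 : ℝ) < m := by exact_mod_cast h.length_pos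
  -- The `k` accounts for windows spoiled by observations, the `1` for the incomplete window at the
  -- end.
  have h4 : (N : ℝ) / m ≤ (freeWindows m o).card + k + 1 := by
    have h5 : N < m * (N / m + 1) := by
      have := Nat.lt_mul_div_succ N h.length_pos
      simpa using this
    have h6 := div_le_card_freeWindows_add m o
    have h7 : N ≤ m * ((freeWindows m o).card + k + 1) :=
      h5.le.trans (Nat.mul_le_mul_left m (by omega))
    rw [div_le_iff₀ hm, mul_comm]
    exact_mod_cast h7
  have h5 := mul_le_mul_of_nonneg_right h4 (mul_nonneg hε0 hZ0)
  have h6 : ∑ σ, pathWeight ν P L o σ * (N - (W σ).card) =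
      N * Z - ∑ σ, pathWeight ν P L o σ * (W σ).card := by
    simp only [mul_sub, Finset.sum_sub_distrib, hZ, Finset.mul_sum]
    congr 1
    exact Finset.sum_congr rfl fun σ _ => mul_comm _ _
  have h7 : ((1 - ε / m) * N + ε * (k + 1)) * Z =
      N * Z - (N / m * (ε * Z)) + (k + 1) * (ε * Z) := by ring
  rw [h7]
  linarith

end Skeleton

/-! ### True jumps of a trajectory with given skeleton, and refinement of the jump times -/

namespace Trajectory

variable {S : Type*} {a b : ℝ}

/-- The position of a point in the increasing enumeration of `T`, counting from `1`. -/
def rank (T : Finset (Ioo a b)) (τ : Ioo a b) : ℕ :=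
  (T.filter fun ρ : Ioo a b => (ρ : ℝ) ≤ τ).card

theorem one_le_rank {T : Finset (Ioo a b)} {τ : Ioo a b} (h : τ ∈ T) : 1 ≤ rank T τ :=
  Finset.card_pos.2 ⟨τ, Finset.mem_filter.2 ⟨h, le_rfl⟩⟩

theorem rank_le_card (T : Finset (Ioo a b)) (τ : Ioo a b) : rank T τ ≤ T.card :=
  Finset.card_filter_le _ _

theorem rank_le_index_iff {T : Finset (Ioo a b)} {τ : Ioo a b} (h : τ ∈ T) (t : Icc a b) :
    rank T τ ≤ index T t ↔ (τ : ℝ) ≤ t := by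
  constructor
  · intro hle
    by_contra hlt
    push Not at hlt
    refine absurd hle (not_le.2 (Finset.card_lt_card ?_))
    refine (Finset.ssubset_iff_of_subset fun ρ hρ => ?_).2 ⟨τ, ?_, ?_⟩
    · rw [Finset.mem_filter] at hρ ⊢
      exact ⟨hρ.1, hρ.2.trans hlt.le⟩
    · exact Finset.mem_filter.2 ⟨h, le_rfl⟩
    · simp [hlt]
  · intro hle
    refine Finset.card_le_card fun ρ hρ => ?_
    rw [Finset.mem_filter] at hρ ⊢
    exact ⟨hρ.1, hρ.2.trans hle⟩

theorem index_coe (T : Finset (Ioo a b)) (τ : Ioo a b) :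
    (index T ⟨τ, Ioo_subset_Icc_self τ.2⟩ : ℕ) = rank T τ :=
  rfl

theorem rank_injOn (T : Finset (Ioo a b)) : Set.InjOn (rank T) T := by
  intro τ hτ ρ hρ e
  refine Subtype.ext (le_antisymm ?_ ?_)
  · exact (rank_le_index_iff hτ ⟨ρ, Ioo_subset_Icc_self ρ.2⟩).1 (by rw [index_coe, e])
  · exact (rank_le_index_iff hρ ⟨τ, Ioo_subset_Icc_self τ.2⟩).1 (by rw [index_coe, e])

/-- No point of `T` lies strictly between `s` and `τ`, so on `[s, τ)` a path with potential jump
times `T` shows its value just before `τ`. -/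
theorem exists_lt_forall_le (T : Finset (Ioo a b)) (τ : Ioo a b) :
    ∃ s : Icc a b, (s : ℝ) < τ ∧ ∀ ρ ∈ T, (ρ : ℝ) < τ → (ρ : ℝ) ≤ s := by
  let U : Finset (Icc a b) := insert ⟨a, left_mem_Icc.2 (τ.2.1.trans τ.2.2).le⟩
    ((T.filter fun ρ : Ioo a b => (ρ : ℝ) < τ).image fun ρ : Ioo a b =>
      (⟨ρ, Ioo_subset_Icc_self ρ.2⟩ : Icc a b))
  have hU : U.Nonempty := Finset.insert_nonempty _ _
  refine ⟨U.max' hU, ?_, fun ρ hρ hlt => ?_⟩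
  · have := U.max'_mem hU
    simp only [U, Finset.mem_insert, Finset.mem_image, Finset.mem_filter] at this
    rcases this with e | ⟨ρ, ⟨-, hρ⟩, e⟩
    · simp only [U]
      rw [e]
      exact τ.2.1
    · simp only [U]
      rw [← e]
      exact hρ
  · refine Subtype.coe_le_coe.2 (U.le_max' ⟨ρ, Ioo_subset_Icc_self ρ.2⟩ ?_)
    simp only [U, Finset.mem_insert, Finset.mem_image, Finset.mem_filter]
    exact Or.inr ⟨ρ, ⟨hρ, hlt⟩, rfl⟩

theorem path_ofSkeleton (T : Finset (Ioo a b)) (σ : Fin (T.card + 1) → S) (t : Icc a b) :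
    (ofSkeleton T σ).path t = natExt σ (index T t) :=
  (natExt_val σ _).symm

/-- Compare `τ` with a time `u` shortly before it: the points of `T` up to `u` are those up to `τ`
with `τ` removed. If `τ ∉ T`, nothing is removed and the path cannot change; otherwise the index
drops by exactly one. -/
theorem mem_and_natExt_ne_of_mem_jumps_ofSkeleton {T : Finset (Ioo a b)}
    {σ : Fin (T.card + 1) → S} {τ : Ioo a b} (h : τ ∈ (ofSkeleton T σ).jumps) :
    τ ∈ T ∧ natExt σ (rank T τ - 1) ≠ natExt σ (rank T τ) := by
  have h' : τ ∈ (ofSkeleton T σ).jumpSet := by simpa [jumps] using h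
  obtain ⟨s, hs, hsT⟩ := exists_lt_forall_le T τ
  obtain ⟨u, hsu, huτ, hne⟩ := h' s hs
  have hsu' : (s : ℝ) ≤ u := hsu
  rw [path_ofSkeleton, path_ofSkeleton, index_coe] at hne
  have hu : (T.filter fun ρ : Ioo a b => (ρ : ℝ) ≤ u) =
      (T.filter fun ρ : Ioo a b => (ρ : ℝ) ≤ τ).erase τ := by
    ext ρ
    simp only [Finset.mem_filter, Finset.mem_erase]
    constructor
    · exact fun ⟨h1, h2⟩ => ⟨fun e => by rw [e] at h2; linarith, h1, h2.trans huτ.le⟩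
    · rintro ⟨h1, h2, h3⟩
      exact ⟨h2, (hsT ρ h2 (lt_of_le_of_ne h3 fun e => h1 (Subtype.ext e))).trans hsu'⟩
  have hi : (index T u : ℕ) = ((T.filter fun ρ : Ioo a b => (ρ : ℝ) ≤ τ).erase τ).card :=
    congrArg Finset.card hu
  have hτ : τ ∈ T := by
    by_contra hτ
    rw [Finset.erase_eq_of_notMem (by simp [hτ])] at hi
    exact hne (by rw [hi]; rfl)
  refine ⟨hτ, ?_⟩
  have hτ' : τ ∈ T.filter fun ρ : Ioo a b => (ρ : ℝ) ≤ τ := Finset.mem_filter.2 ⟨hτ, le_rfl⟩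
  rwa [hi, Finset.card_erase_of_mem hτ'] at hne

/-- A true jump at the point of rank `r` comes from the move from position `r - 1` to `r`, and ranks
are injective on `T`. Ranks start at `1`, so the truncated subtraction loses nothing. -/
theorem card_jumps_ofSkeleton_le [DecidableEq S] (T : Finset (Ioo a b))
    (σ : Fin (T.card + 1) → S) : (ofSkeleton T σ).jumps.card ≤ moveCount σ := by
  refine Finset.card_le_card_of_injOn (fun τ => rank T τ - 1) (fun τ hτ => ?_) ?_
  · obtain ⟨h1, h2⟩ := mem_and_natExt_ne_of_mem_jumps_ofSkeleton hτ
    have h3 := one_le_rank h1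
    have h4 := rank_le_card T τ
    simp only [Finset.coe_filter, Finset.mem_range, mem_ofPred_eq]
    refine ⟨by omega, ?_⟩
    rwa [Nat.sub_add_cancel h3]
  · intro τ hτ ρ hρ e
    have h1 := (mem_and_natExt_ne_of_mem_jumps_ofSkeleton hτ).1
    have h2 := (mem_and_natExt_ne_of_mem_jumps_ofSkeleton hρ).1
    have h3 := one_le_rank h1
    have h4 := one_le_rank h2
    simp only at e
    exact rank_injOn T h1 h2 (by omega)

/-- The number of points of `T` among the first `n` points of `T'`. -/
def coarseIndex (T T' : Finset (Ioo a b)) (n : ℕ) : ℕ :=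
  (T.filter fun τ => rank T' τ ≤ n).card

theorem coarseIndex_zero {T T' : Finset (Ioo a b)} (h : T ⊆ T') : coarseIndex T T' 0 = 0 := by
  rw [coarseIndex, Finset.card_eq_zero, Finset.filter_eq_empty_iff]
  intro τ hτ
  have := one_le_rank (h hτ)
  omega

theorem coarseIndex_le (T T' : Finset (Ioo a b)) (n : ℕ) : coarseIndex T T' n ≤ T.card :=
  Finset.card_filter_le _ _

/-- At most one point of `T` has rank `n + 1` in `T'`. Hence a skeleton on `T`, read along `T'`,
either stays put or makes its next transition. -/
theorem coarseIndex_succ {T T' : Finset (Ioo a b)} (h : T ⊆ T') (n : ℕ) :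
    coarseIndex T T' (n + 1) = coarseIndex T T' n ∨
      coarseIndex T T' (n + 1) = coarseIndex T T' n + 1 := by
  have h1 : coarseIndex T T' n ≤ coarseIndex T T' (n + 1) :=
    Finset.card_le_card (Finset.monotone_filter_right _ fun τ _ hτ => by omega)
  have h2 : coarseIndex T T' (n + 1) ≤ coarseIndex T T' n + 1 := by
    have h3 : (T.filter fun τ => rank T' τ ≤ n + 1) ⊆
        (T.filter fun τ => rank T' τ ≤ n) ∪ (T.filter fun τ => rank T' τ = n + 1) := by
      intro τ hτ
      simp only [Finset.mem_union, Finset.mem_filter] at hτ ⊢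
      have := hτ.1
      have := hτ.2
      rcases Nat.lt_or_ge n (rank T' τ) with h | h
      · exact Or.inr ⟨hτ.1, by omega⟩
      · exact Or.inl ⟨hτ.1, h⟩
    have h4 : (T.filter fun τ => rank T' τ = n + 1).card ≤ 1 := by
      refine Finset.card_le_one.2 fun τ hτ ρ hρ => ?_
      rw [Finset.mem_filter] at hτ hρ
      exact rank_injOn T' (h hτ.1) (h hρ.1) (hτ.2.trans hρ.2.symm)
    exact (Finset.card_le_card h3).trans ((Finset.card_union_le _ _).trans
      (Nat.add_le_add_left h4 _))
  omega

theorem coarseIndex_index {T T' : Finset (Ioo a b)} (h : T ⊆ T') (t : Icc a b) :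
    coarseIndex T T' (index T' t) = index T t :=
  congrArg Finset.card (Finset.filter_congr fun _ hτ => rank_le_index_iff (h hτ) t)

end Trajectory

/-- Passing to a measurable minorant with the same integral removes any measurability requirement on
`f`; it is applied to the number of jumps. -/
theorem lintegral_dirac_le {α : Type*} [MeasurableSpace α] (x : α) (f : α → ℝ≥0∞) :
    ∫⁻ y, f y ∂(Measure.dirac x) ≤ f x := by
  obtain ⟨g, hg, hgf, e⟩ := exists_measurable_le_lintegral_eq (μ := Measure.dirac x) f
  rw [e, lintegral_dirac' _ hg]
  exact hgf x

/-! ### The uniformized chain and the skeleton stage -/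

namespace HiddenMJP

variable {S : Type*} [Fintype S]

theorem nonempty (M : HiddenMJP S) : Nonempty S := by
  by_contra h
  rw [not_nonempty_iff] at h
  simpa using M.sum_init

variable [DecidableEq S]

theorem exitRate_nonneg (M : HiddenMJP S) (s : S) : 0 ≤ M.exitRate s :=
  Finset.sum_nonneg fun s' hs' => M.rate_nonneg s s' (Finset.ne_of_mem_erase hs').symm

variable {M : HiddenMJP S} {lam : ℝ}

theorem lam_pos (hlam : ∀ s, M.exitRate s < lam) : 0 < lam := by
  obtain ⟨s⟩ := M.nonempty
  exact (M.exitRate_nonneg s).trans_lt (hlam s)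

theorem transition_self_pos (hlam : ∀ s, M.exitRate s < lam) (s : S) :
    0 < M.transition lam s s := by
  rw [transition, if_pos rfl, sub_pos, div_lt_one (lam_pos hlam)]
  exact hlam s

theorem transition_nonneg (hlam : ∀ s, M.exitRate s < lam) (s s' : S) :
    0 ≤ M.transition lam s s' := by
  rcases eq_or_ne s s' with rfl | h
  · exact (transition_self_pos hlam s).le
  · rw [transition, if_neg h]
    exact div_nonneg (M.rate_nonneg s s' h) (lam_pos hlam).le

theorem transition_le_one (hlam : ∀ s, M.exitRate s < lam) (s s' : S) :
    M.transition lam s s' ≤ 1 := by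
  rcases eq_or_ne s s' with rfl | h
  · rw [transition, if_pos rfl]
    have := div_nonneg (M.exitRate_nonneg s) (lam_pos hlam).le
    linarith
  · rw [transition, if_neg h, div_le_one (lam_pos hlam)]
    refine le_trans ?_ (hlam s).le
    exact Finset.single_le_sum (f := fun s' => M.rate s s')
      (fun u hu => M.rate_nonneg s u (Finset.ne_of_mem_erase hu).symm)
      (Finset.mem_erase.2 ⟨h.symm, Finset.mem_univ _⟩)

/-- Once `s'` is reached the path waits there, which is possible since `P(s',s') > 0`. Paths of
different lengths can thus be brought to a common length. -/
theorem exists_path (hirr : M.Irreducible) (hlam : ∀ s, M.exitRate s < lam) (s s' : S) :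
    ∃ n, ∃ f : ℕ → S, f 0 = s ∧ (∀ i, n ≤ i → f i = s') ∧
      ∀ i, 0 < M.transition lam (f i) (f (i + 1)) := by
  induction hirr s s' using Relation.ReflTransGen.head_induction_on with
  | refl => exact ⟨0, fun _ => s', rfl, fun _ _ => rfl, fun _ => transition_self_pos hlam _⟩
  | @head u v huv _ ih =>
    obtain ⟨n, f, h0, hn, hpos⟩ := ih
    refine ⟨n + 1, fun i => Nat.casesOn i u f, rfl, fun i hi => ?_, fun i => ?_⟩
    · obtain ⟨j, rfl⟩ : ∃ j, i = j + 1 := ⟨i - 1, by omega⟩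
      exact hn j (by omega)
    · cases i with
      | zero =>
        change 0 < M.transition lam u (f 0)
        rw [h0, transition, if_neg huv.1]
        exact div_pos huv.2 (lam_pos hlam)
      | succ i => exact hpos i

/-- Let `B` bound the lengths of the paths between all pairs of states and take `m = B + 1`: the
last step, from `B` to `B + 1`, is then always a stay. The constant `η` is the least weight over the
finitely many pairs. -/
theorem exists_stayingBridge (hirr : M.Irreducible) (hlam : ∀ s, M.exitRate s < lam) :
    ∃ m c η, StayingBridge (M.transition lam) m c η := by
  have := M.nonempty
  choose n c h0 hn hpos using exists_path hirr hlam
  obtain ⟨B, hB⟩ : ∃ B, ∀ s s', n s s' ≤ B :=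
    ⟨Finset.univ.sup fun p : S × S => n p.1 p.2, fun s s' =>
      Finset.le_sup (f := fun p : S × S => n p.1 p.2) (Finset.mem_univ (s, s'))⟩
  obtain ⟨p, hp⟩ := Finite.exists_min fun p : S × S =>
    ∏ l ∈ Finset.range (B + 1), M.transition lam (c p.1 p.2 l) (c p.1 p.2 (l + 1))
  refine ⟨B + 1, c, _, Nat.succ_pos B, h0, fun s s' => hn s s' _ ((hB s s').trans (by omega)),
    fun s s' => ⟨B, by omega, ?_⟩, ?_, fun s s' => hp (s, s')⟩
  · rw [hn s s' B (hB s s'), hn s s' (B + 1) ((hB s s').trans (by omega))]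
  · exact Finset.prod_pos fun l _ => hpos _ _ l

theorem skeletonWeight_nonneg (hlam : ∀ s, M.exitRate s < lam) (T : Finset (Ioo M.tmin M.tmax))
    (σ : Fin (T.card + 1) → S) : 0 ≤ M.skeletonWeight lam T σ :=
  pathWeight_nonneg (transition_nonneg hlam) M.init_nonneg M.lik_nonneg σ

/-- Adding virtual jump times keeps the normalizing constant positive. -/
theorem normalizer_pos_of_subset (hlam : ∀ s, M.exitRate s < lam)
    {T T' : Finset (Ioo M.tmin M.tmax)} (h : T ⊆ T') (hT : 0 < M.normalizer lam T) :
    0 < M.normalizer lam T' := by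
  obtain ⟨σ, -, hσ⟩ := Finset.exists_lt_of_sum_lt (s := Finset.univ)
    (f := fun _ : Fin (T.card + 1) → S => (0 : ℝ)) (g := M.skeletonWeight lam T)
    (by simpa [normalizer] using hT)
  have hw : M.skeletonWeight lam T σ ≠ 0 := hσ.ne'
  -- The same trajectory, staying put at the points of `T'` outside `T`.
  let σ' : Fin (T'.card + 1) → S := fun i => natExt σ (Trajectory.coarseIndex T T' i)
  have e1 : Trajectory.ofSkeleton T' σ' = Trajectory.ofSkeleton T σ := by
    have : (Trajectory.ofSkeleton T' σ').path = (Trajectory.ofSkeleton T σ).path := by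
      funext t
      rw [Trajectory.path_ofSkeleton, Trajectory.path_ofSkeleton, natExt_val]
      simp only [σ', Trajectory.coarseIndex_index h]
    cases h1 : Trajectory.ofSkeleton T' σ'
    cases h2 : Trajectory.ofSkeleton T σ
    rw [h1, h2] at this
    simpa using this
  have e2 : σ' 0 = σ 0 := by
    rw [← natExt_val σ 0]
    simp only [σ', Fin.val_zero, Trajectory.coarseIndex_zero h]
  have hpos : 0 < M.skeletonWeight lam T' σ' := by
    refine (skeletonWeight_nonneg hlam T' σ').lt_of_ne' ?_
    unfold skeletonWeight skeletonPrior at hw ⊢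
    rw [e1, e2]
    refine mul_ne_zero (mul_ne_zero (fun e => hw (by simp [e])) ?_) (fun e => hw (by simp [e]))
    refine Finset.prod_ne_zero_iff.2 fun i _ => ?_
    simp only [σ', Fin.val_castSucc, Fin.val_succ]
    -- The factor is either some `P(s,s) > 0` or a factor of the nonzero weight of `σ`.
    rcases Trajectory.coarseIndex_succ h i with e | e
    · rw [e]
      exact (transition_self_pos hlam _).ne'
    · rw [e]
      have hlt : Trajectory.coarseIndex T T' i < T.card := by
        have := Trajectory.coarseIndex_le T T' (i + 1)
        omega
      have hp : ∏ n ∈ Finset.range T.card,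
          M.transition lam (natExt σ n) (natExt σ (n + 1)) ≠ 0 := by
        rw [← prod_fin_eq_prod_range_natExt]
        exact fun e => hw (by simp [e])
      exact Finset.prod_ne_zero_iff.1 hp _ (Finset.mem_range.2 hlt)
  exact hpos.trans_le (Finset.single_le_sum (f := M.skeletonWeight lam T')
    (fun σ _ => skeletonWeight_nonneg hlam T' σ) (Finset.mem_univ σ'))

theorem isProbabilityMeasure_skeletonStage (hlam : ∀ s, M.exitRate s < lam)
    {T : Finset (Ioo M.tmin M.tmax)} (hT : 0 < M.normalizer lam T) :
    IsProbabilityMeasure (M.skeletonStage lam T) := by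
  refine ⟨?_⟩
  simp only [skeletonStage, Measure.finsetSum_apply, Measure.smul_apply, measure_univ,
    smul_eq_mul, mul_one]
  rw [← ENNReal.ofReal_sum_of_nonneg fun σ _ =>
    div_nonneg (skeletonWeight_nonneg hlam T σ) hT.le, ← Finset.sum_div]
  rw [← normalizer, div_self hT.ne', ENNReal.ofReal_one]

/-- The mean number of jumps of the trajectory resulting from stage (S). -/
theorem lintegral_card_jumps_skeletonStage_le (hlam : ∀ s, M.exitRate s < lam) {m : ℕ}
    {c : S → S → ℕ → S} {η ε : ℝ} (h : StayingBridge (M.transition lam) m c η) (hε0 : 0 ≤ ε)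
    (hε : ε ≤ η / (Fintype.card S ^ m : ℕ)) {T : Finset (Ioo M.tmin M.tmax)}
    (hT : 0 < M.normalizer lam T) :
    ∫⁻ X, (X.jumps.card : ℝ≥0∞) ∂(M.skeletonStage lam T) ≤
      ENNReal.ofReal ((1 - ε / m) * T.card + ε * (M.k + 1)) := by
  rw [skeletonStage, lintegral_finsetSum_measure]
  have h1 : ∀ σ : Fin (T.card + 1) → S,
      ∫⁻ X, (X.jumps.card : ℝ≥0∞) ∂(ENNReal.ofReal (M.skeletonWeight lam T σ /
        M.normalizer lam T) • Measure.dirac (Trajectory.ofSkeleton T σ)) ≤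
      ENNReal.ofReal (M.skeletonWeight lam T σ * moveCount σ / M.normalizer lam T) := by
    intro σ
    rw [lintegral_smul_measure, smul_eq_mul, mul_div_right_comm,
      ENNReal.ofReal_mul (div_nonneg (skeletonWeight_nonneg hlam T σ) hT.le),
      ENNReal.ofReal_natCast]
    gcongr
    exact (lintegral_dirac_le _ _).trans
      (by exact_mod_cast Trajectory.card_jumps_ofSkeleton_le T σ)
  refine (Finset.sum_le_sum fun σ _ => h1 σ).trans ?_
  rw [← ENNReal.ofReal_sum_of_nonneg fun σ _ => div_nonneg
    (mul_nonneg (skeletonWeight_nonneg hlam T σ) (Nat.cast_nonneg _)) hT.le, ← Finset.sum_div]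
  refine ENNReal.ofReal_le_ofReal ?_
  rw [div_le_iff₀ hT]
  -- By unfolding, `skeletonWeight` is a `pathWeight` in which observation `j` sits at the index of
  -- its time.
  exact h.sum_pathWeight_mul_moveCount_le (transition_nonneg hlam) (transition_le_one hlam)
    (fun j => Trajectory.index T (M.obsTime j)) M.init_nonneg M.lik_nonneg hε0 hε

end HiddenMJP

/-! ### Measurable dependence of the skeleton stage on the virtual jumps -/

section Measurability

theorem measurable_sigma_iff {ι γ : Type*} {β : ι → Type*} [∀ i, MeasurableSpace (β i)]
    [MeasurableSpace γ] {f : (Σ i, β i) → γ} :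
    Measurable f ↔ ∀ i, Measurable fun x : β i => f ⟨i, x⟩ :=
  ⟨fun hf i _ hA => MeasurableSpace.measurableSet_iInf.1 (hf hA) i,
    fun hf _ hA => MeasurableSpace.measurableSet_iInf.2 fun i => hf i hA⟩

theorem measurable_sigma_mk {ι : Type*} {β : ι → Type*} [∀ i, MeasurableSpace (β i)] (i : ι) :
    Measurable (Sigma.mk i : β i → Σ i, β i) :=
  measurable_sigma_iff.1 measurable_id i

theorem measurable_comp_sigma_fst {ι γ : Type*} {β : ι → Type*} [∀ i, MeasurableSpace (β i)]
    [MeasurableSpace γ] (f : ι → γ) : Measurable fun x : Σ i, β i => f x.1 :=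
  measurable_sigma_iff.2 fun i => measurable_const (a := f i)

/-- The listed points may repeat or hit `J`, so each new point is counted at its first occurrence.
This makes the cardinality a finite sum of indicators, whose measurability is visible. -/
theorem card_filter_union_image {E : Type*} [DecidableEq E] (J : Finset E) {n : ℕ} (V : Fin n → E)
    (p : E → Prop) [DecidablePred p] :
    ((J ∪ Finset.univ.image V).filter p).card = (J.filter p).card +
      ∑ i, if p (V i) ∧ V i ∉ J ∧ ∀ j < i, V j ≠ V i then 1 else 0 := by
  rw [← Finset.sum_filter, Finset.sum_const, smul_eq_mul, mul_one]
  set I := Finset.univ.filter fun i => p (V i) ∧ V i ∉ J ∧ ∀ j < i, V j ≠ V i with hI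
  have hinj : Set.InjOn V I := by
    intro i hi j hj e
    simp only [hI, Finset.coe_filter, mem_ofPred_eq] at hi hj
    rcases lt_trichotomy i j with h | h | h
    · exact absurd e (hj.2.2.2 i h)
    · exact h
    · exact absurd e.symm (hi.2.2.2 j h)
  have hdisj : Disjoint (J.filter p) (I.image V) := by
    rw [Finset.disjoint_left]
    intro x hx hx'
    obtain ⟨i, hi, rfl⟩ := Finset.mem_image.1 hx'
    exact (Finset.mem_filter.1 hi).2.2.1 (Finset.mem_filter.1 hx).1
  rw [← Finset.card_image_of_injOn hinj, ← Finset.card_union_of_disjoint hdisj]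
  congr 1
  ext x
  simp only [Finset.mem_filter, Finset.mem_union, Finset.mem_image, Finset.mem_univ, true_and, hI]
  constructor
  · rintro ⟨h, hp⟩
    by_cases hx : x ∈ J
    · exact Or.inl ⟨hx, hp⟩
    · obtain ⟨i, hi⟩ := h.resolve_left hx
      obtain ⟨i₀, h₀, hmin⟩ := WellFounded.has_min (wellFounded_lt (α := Fin n)) {i | V i = x}
        ⟨i, hi⟩
      have h₀' : V i₀ = x := h₀
      exact Or.inr ⟨i₀, by rw [h₀']; exact ⟨hp, hx, fun j hj e => hmin j e hj⟩, h₀⟩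
  · rintro (⟨h, hp⟩ | ⟨i, ⟨hp, -, -⟩, rfl⟩)
    · exact ⟨Or.inl h, hp⟩
    · exact ⟨Or.inr ⟨i, rfl⟩, hp⟩

theorem measurable_card_filter_union_image {E : Type*} [DecidableEq E] [MeasurableSpace E]
    [MeasurableSingletonClass E] [MeasurableEq E] (J : Finset E) (n : ℕ) (p : E → Prop)
    [DecidablePred p] (hp : MeasurableSet {x | p x}) :
    Measurable fun V : Fin n → E => ((J ∪ Finset.univ.image V).filter p).card := by
  simp only [card_filter_union_image]
  refine measurable_const.add (Finset.measurable_fun_sum _ fun i _ => ?_)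
  refine Measurable.ite ?_ measurable_const measurable_const
  refine MeasurableSet.inter (measurable_pi_apply i hp) (MeasurableSet.inter ?_ ?_)
  · have h : MeasurableSet {x | x ∉ J} := J.finite_toSet.measurableSet.compl
    exact (measurable_pi_apply (X := fun _ : Fin n => E) i) h
  · have : {V : Fin n → E | ∀ j < i, V j ≠ V i} = ⋂ j, ⋂ (_ : j < i), {V | V j = V i}ᶜ := by
      ext V
      simp
    change MeasurableSet {V : Fin n → E | ∀ j < i, V j ≠ V i}
    rw [this]
    exact MeasurableSet.iInter fun j => MeasurableSet.iInter fun _ =>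
      (measurableSet_eq_fun (measurable_pi_apply j) (measurable_pi_apply i)).compl

theorem Trajectory.measurable_iff {S : Type*} {a b : ℝ} {α : Type*} [MeasurableSpace α]
    {f : α → Trajectory S a b} :
    Measurable f ↔ ∀ t (A : Set S), MeasurableSet {x | (f x).path t ∈ A} := by
  constructor
  · intro hf t A
    refine hf (t := {X | X.path t ∈ A}) ?_
    exact le_iSup (fun t : Icc a b =>
      MeasurableSpace.comap (fun X : Trajectory S a b => X.path t) ⊤) t _ ⟨A, trivial, rfl⟩
  · intro h
    rw [measurable_iff_comap_le]
    change MeasurableSpace.comap f (⨆ t : Icc a b, _) ≤ _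
    rw [MeasurableSpace.comap_iSup]
    refine iSup_le fun t => ?_
    rw [MeasurableSpace.comap_comp]
    rintro _ ⟨A, -, rfl⟩
    exact h t A

/-- For fixed potential jump times of the form `J ∪ V`, the trajectory depends measurably on `V`. -/
theorem Trajectory.measurable_ofSkeleton_union_image {S : Type*} {a b : ℝ}
    (J : Finset (Ioo a b)) (n : ℕ) (σ : ℕ → S) :
    Measurable fun V : Fin n → Ioo a b =>
      ofSkeleton (J ∪ Finset.univ.image V) fun i => σ i := by
  refine Trajectory.measurable_iff.2 fun t A => ?_
  have h : Measurable fun V : Fin n → Ioo a b =>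
      (index (J ∪ Finset.univ.image V) t : ℕ) :=
    measurable_card_filter_union_image J n (fun τ : Ioo a b => (τ : ℝ) ≤ t)
      (measurableSet_le measurable_subtype_coe measurable_const)
  exact h (t := {i | σ i ∈ A}) (MeasurableSet.of_discrete)

end Measurability

namespace HiddenMJP

variable {S : Type*} [Fintype S]

theorem measurable_likelihood (M : HiddenMJP S) : Measurable M.likelihood := by
  refine Finset.measurable_fun_prod _ fun j _ => ?_
  intro B _
  exact Trajectory.measurable_iff.1 measurable_id (M.obsTime j) (M.lik j ⁻¹' B)

variable [DecidableEq S]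

/-- The type of skeletons varies with the number of potential jump times. So the measure is first
formed for skeletons of an arbitrary fixed length `r + 1`, measurably in `V`; then the measurable,
integer-valued cardinality is substituted for `r`. -/
theorem measurable_skeletonStage (M : HiddenMJP S) (lam : ℝ) (J : Finset (Ioo M.tmin M.tmax))
    (n : ℕ) :
    Measurable fun V : Fin n → Ioo M.tmin M.tmax =>
      M.skeletonStage lam (J ∪ Finset.univ.image V) := by
  let w (r : ℕ) (σ : Fin (r + 1) → S) (V : Fin n → Ioo M.tmin M.tmax) : ℝ :=
    (M.init (σ 0) * ∏ i : Fin r, M.transition lam (σ i.castSucc) (σ i.succ)) *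
      M.likelihood (Trajectory.ofSkeleton (J ∪ Finset.univ.image V) fun i => natExt σ i)
  let F (r : ℕ) (V : Fin n → Ioo M.tmin M.tmax) : Measure (Trajectory S M.tmin M.tmax) :=
    ∑ σ : Fin (r + 1) → S, ENNReal.ofReal (w r σ V / ∑ σ', w r σ' V) •
      Measure.dirac (Trajectory.ofSkeleton (J ∪ Finset.univ.image V) fun i => natExt σ i)
  have hw : ∀ r σ, Measurable (w r σ) := fun r σ => measurable_const.mul
    (M.measurable_likelihood.comp (Trajectory.measurable_ofSkeleton_union_image J n _))
  have hF : ∀ r, Measurable (F r) := by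
    intro r
    refine Measure.measurable_of_measurable_coe _ fun A hA => ?_
    simp only [F, Measure.finsetSum_apply, Measure.smul_apply, smul_eq_mul]
    refine Finset.measurable_fun_sum _ fun σ _ => Measurable.mul ?_ ?_
    · exact ((hw r σ).div (Finset.measurable_fun_sum _ fun σ' _ => hw r σ')).ennreal_ofReal
    · exact (Measure.measurable_coe hA).comp (Measure.measurable_dirac.comp
        (Trajectory.measurable_ofSkeleton_union_image J n _))
  have hcard : Measurable fun V : Fin n → Ioo M.tmin M.tmax =>
      (J ∪ Finset.univ.image V).card := by
    simpa using measurable_card_filter_union_image J n (fun _ => True) MeasurableSet.univ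
  have hFF : Measurable fun p : (Fin n → Ioo M.tmin M.tmax) × ℕ => F p.2 p.1 :=
    measurable_from_prod_countable_left hF
  convert hFF.comp (measurable_id.prodMk hcard) using 1
  funext V
  simp only [Function.comp, id, F, w, natExt_val]
  rfl

end HiddenMJP

/-! ### Total mass and mean number of points of a Poisson process -/

section PoissonProcess

variable {E : Type*} [MeasurableSpace E] (Λ : Measure E) [IsFiniteMeasure Λ]

theorem lintegral_poissonProcessLaw_fst (f : ℕ → ℝ≥0∞) :
    ∫⁻ V, f V.1 ∂(poissonProcessLaw Λ) =
      ∑' n, ENNReal.ofReal (Real.exp (-Λ.real univ) * (Λ.real univ ^ n / n.factorial)) * f n := by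
  rw [poissonProcessLaw, lintegral_sum_measure]
  refine tsum_congr fun n => ?_
  have hc : ∫⁻ v : Fin n → E, f (Sigma.mk (β := fun n : ℕ => Fin n → E) n v).1
      ∂(Measure.pi fun _ => Λ) = f n * Measure.pi (fun _ : Fin n => Λ) univ :=
    lintegral_const (f n)
  rw [lintegral_smul_measure, lintegral_map (measurable_comp_sigma_fst f) (measurable_sigma_mk n),
    hc, Measure.pi_univ]
  simp only [Finset.prod_const, Finset.card_univ, Fintype.card_fin, smul_eq_mul]
  rw [mul_comm (f n), ← mul_assoc, ← ofReal_measureReal (measure_ne_top Λ univ),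
    ← ENNReal.ofReal_pow measureReal_nonneg, ← ENNReal.ofReal_mul (by positivity)]
  congr 2
  rw [ENNReal.toReal_ofReal measureReal_nonneg]
  ring

instance : IsProbabilityMeasure (poissonProcessLaw Λ) := by
  refine ⟨?_⟩
  have h := lintegral_poissonProcessLaw_fst Λ fun _ => 1
  rw [lintegral_one] at h
  have hs : HasSum (fun n : ℕ => Real.exp (-Λ.real univ) * (Λ.real univ ^ n / n.factorial)) 1 := by
    have := (NormedSpace.expSeries_div_hasSum_exp (Λ.real univ)).mul_left (Real.exp (-Λ.real univ))
    rwa [← Real.exp_eq_exp_ℝ, ← Real.exp_add, neg_add_cancel, Real.exp_zero] at this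
  rw [h]
  simp only [mul_one]
  rw [← ENNReal.ofReal_tsum_of_nonneg (fun n => by positivity) hs.summable, hs.tsum_eq,
    ENNReal.ofReal_one]

/-- The mean number of points of a Poisson process. -/
theorem lintegral_card_poissonProcessLaw :
    ∫⁻ V, (V.1 : ℝ≥0∞) ∂(poissonProcessLaw Λ) = Λ univ := by
  rw [lintegral_poissonProcessLaw_fst Λ fun n => (n : ℝ≥0∞)]
  set x := Λ.real univ with hx
  have hs : HasSum (fun n : ℕ => Real.exp (-x) * (x ^ n / n.factorial) * n) x := by
    -- The term `n = 0` vanishes and `(n + 1) x^(n+1) / (n+1)! = x · x^n / n!`, so the shifted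
    -- series is `x` times the exponential series.
    rw [← hasSum_nat_add_iff' 1]
    have := (NormedSpace.expSeries_div_hasSum_exp x).mul_left (x * Real.exp (-x))
    rw [← Real.exp_eq_exp_ℝ, mul_assoc, ← Real.exp_add, neg_add_cancel, Real.exp_zero,
      mul_one] at this
    have e : x - ∑ i ∈ Finset.range 1, Real.exp (-x) * (x ^ i / i.factorial) * i = x := by simp
    rw [e]
    refine (congrArg (HasSum · x) (funext fun n => ?_)).mp this
    rw [Nat.factorial_succ]
    push_cast
    have : (n : ℝ) + 1 ≠ 0 := by positivity
    field_simp
    ring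
  calc _ = ∑' n : ℕ, ENNReal.ofReal (Real.exp (-x) * (x ^ n / n.factorial) * n) := by
        refine tsum_congr fun n => ?_
        rw [ENNReal.ofReal_mul (p := Real.exp (-x) * (x ^ n / n.factorial)) (by positivity),
          ENNReal.ofReal_natCast]
    _ = Λ univ := by
        rw [← ENNReal.ofReal_tsum_of_nonneg (fun n => by positivity) hs.summable, hs.tsum_eq,
          hx, ofReal_measureReal]

end PoissonProcess

/-! ### Bound on the intensity of virtual jumps -/

namespace HiddenMJP

variable {S : Type*} [Fintype S] [DecidableEq S] {M : HiddenMJP S} {lam : ℝ}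

/-- Exit rates are nonnegative, so the intensity never exceeds `λ`. The bound is uniform in `X`, as
the additive constant of the drift inequality must be. -/
theorem virtualIntensity_univ_le (M : HiddenMJP S) (lam : ℝ) (X : Trajectory S M.tmin M.tmax) :
    M.virtualIntensity lam X univ ≤ ENNReal.ofReal lam * ENNReal.ofReal (M.tmax - M.tmin) := by
  rw [virtualIntensity, withDensity_apply _ MeasurableSet.univ, Measure.restrict_univ]
  calc _ ≤ ∫⁻ _, ENNReal.ofReal lam ∂(volume.comap (Subtype.val : Ioo M.tmin M.tmax → ℝ)) :=
        lintegral_mono fun t => ENNReal.ofReal_le_ofReal (sub_le_self _ (M.exitRate_nonneg _))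
    _ = _ := by
        rw [lintegral_const, comap_subtype_coe_apply measurableSet_Ioo, image_univ,
          Subtype.range_coe, Real.volume_Ioo]

instance (X : Trajectory S M.tmin M.tmax) : IsFiniteMeasure (M.virtualIntensity lam X) :=
  ⟨(M.virtualIntensity_univ_le lam X).trans_lt
    (ENNReal.mul_lt_top ENNReal.ofReal_lt_top ENNReal.ofReal_lt_top)⟩

end HiddenMJP

end

/-! ### The drift inequality -/

theorem proposition1 {S : Type*} [Fintype S] [DecidableEq S] (M : HiddenMJP S) (lam : ℝ)
    (hirr : M.Irreducible) (hlam : ∀ s, M.exitRate s < lam) :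
    ∃ q c : ℝ≥0, q < 1 ∧
      ∀ X : Trajectory S M.tmin M.tmax, 0 < M.normalizer lam X.jumps →
        IsProbabilityMeasure (M.raoTehStep lam X) ∧
        ∫⁻ X', (X'.jumps.card : ℝ≥0∞) ∂(M.raoTehStep lam X) ≤
          (q : ℝ≥0∞) * (X.jumps.card : ℝ≥0∞) + (c : ℝ≥0∞) := by
  obtain ⟨m, c, η, h⟩ := HiddenMJP.exists_stayingBridge hirr hlam
  have := M.nonempty
  set ε : ℝ := η / (Fintype.card S ^ m : ℕ) with hε
  have hε0 : 0 < ε := div_pos h.weight_pos (by exact_mod_cast pow_pos Fintype.card_pos m)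
  have hm : (0 : ℝ) < m := by exact_mod_cast h.length_pos
  have hεm : 0 < ε / m := div_pos hε0 hm
  -- Truncation at `0` avoids having to show `ε ≤ m`.
  set q : ℝ≥0 := (1 - ε / m).toNNReal with hq
  set c₀ : ℝ≥0 := (ε * (M.k + 1)).toNNReal with hc₀
  have hq1 : q < 1 := by
    rw [hq, Real.toNNReal_lt_one]
    linarith
  -- The additive constant is `q` times the bound on the mean number of virtual jumps, plus the cost
  -- `ε (k + 1)` of the unusable windows.
  refine ⟨q, q * (lam.toNNReal * (M.tmax - M.tmin).toNNReal) + c₀, hq1, fun X hX => ?_⟩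
  have hpos : ∀ V : Σ n : ℕ, (Fin n → Ioo M.tmin M.tmax),
      0 < M.normalizer lam (X.jumps ∪ Finset.univ.image V.2) := fun V =>
    HiddenMJP.normalizer_pos_of_subset hlam Finset.subset_union_left hX
  have hmeas : Measurable fun V : Σ n : ℕ, (Fin n → Ioo M.tmin M.tmax) =>
      M.skeletonStage lam (X.jumps ∪ Finset.univ.image V.2) :=
    measurable_sigma_iff.2 fun n => M.measurable_skeletonStage lam X.jumps n
  refine ⟨isProbabilityMeasure_bind hmeas.aemeasurable (Filter.Eventually.of_forall fun V =>
    HiddenMJP.isProbabilityMeasure_skeletonStage hlam (hpos V)), ?_⟩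
  have hstage : ∀ V : Σ n : ℕ, (Fin n → Ioo M.tmin M.tmax),
      ∫⁻ X', (X'.jumps.card : ℝ≥0∞)
        ∂(M.skeletonStage lam (X.jumps ∪ Finset.univ.image V.2)) ≤
      (q * X.jumps.card + c₀) + q * V.1 := by
    intro V
    refine (HiddenMJP.lintegral_card_jumps_skeletonStage_le hlam h hε0.le le_rfl
      (hpos V)).trans ?_
    -- Subadditivity holds whatever the sign of `1 - ε / m`.
    refine ENNReal.ofReal_add_le.trans ?_
    rw [add_right_comm]
    gcongr
    · rw [ENNReal.ofReal_mul' (Nat.cast_nonneg _), ENNReal.ofReal_natCast, ← mul_add]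
      refine mul_le_mul' le_rfl ?_
      have h1 : (Finset.univ.image V.2).card ≤ V.1 := by
        simpa using Finset.card_image_le (s := Finset.univ) (f := V.2)
      exact_mod_cast (Finset.card_union_le _ _).trans (Nat.add_le_add_left h1 _)
    · exact le_rfl
  have hfst : Measurable fun V : Σ n : ℕ, (Fin n → Ioo M.tmin M.tmax) => (V.1 : ℝ≥0∞) :=
    measurable_comp_sigma_fst _
  -- The inequality for `bind` is enough here and, unlike equality, asks for no measurability of the
  -- number of jumps.
  calc _ ≤ ∫⁻ V, _ ∂(poissonProcessLaw (M.virtualIntensity lam X)) :=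
        Measure.lintegral_bind_le _ _ _
    _ ≤ ∫⁻ V, ((q * X.jumps.card + c₀) + q * V.1 : ℝ≥0∞)
          ∂(poissonProcessLaw (M.virtualIntensity lam X)) := lintegral_mono hstage
    _ = (q * X.jumps.card + c₀) + q * M.virtualIntensity lam X univ := by
        rw [lintegral_add_left measurable_const, lintegral_const, measure_univ, mul_one,
          lintegral_const_mul _ hfst, lintegral_card_poissonProcessLaw]
    _ ≤ (q * X.jumps.card + c₀) +
          q * (ENNReal.ofReal lam * ENNReal.ofReal (M.tmax - M.tmin)) := by
        gcongr
        exact M.virtualIntensity_univ_le lam X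
    _ = _ := by
        push_cast
        rw [ENNReal.ofReal, ENNReal.ofReal]
        ring
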